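/- Let $S=\mathbb{C}[x_0,x_1,x_2,x_3]$ and let $V(f):f=0$ be a surface in $\mathbb{P}^3$ with (at most) isolated singularities, where $f\in S_d$ is homogeneous of degree $d\ge 3$. Let $J(f)\subset S$ be the Jacobian ideal generated by the first order partial derivatives of $f$, and let $M(f)=S/J(f)$ be the graded Jacobian algebra. Let $H:\ell=0$ be a plane in $\mathbb{P}^3$, with $\ell\in S_1$ nonzero, which contains no singular point of $V(f)$. Choose linear coordinates $y_1,y_2,y_3$ on $H$, put $R=\mathbb{C}[y_1,y_2,y_3]$, and let $g\in R_d$ be the restriction of $f$ to $H$, so that the plane section $V(f)\cap H$ is the plane curve $g=0$. Write $g_j=\partial g/\partial y_j$, let $$\mathrm{Syz}(g)=\{(a_1,a_2,a_3)\in R^3 : a_1g_1+a_2g_2+a_3g_3=0\}$$ be the graded module of first order syzygies, and let $N(g)=I(g)/J(g)$, where $J(g)=(g_1,g_2,g_3)$ and $I(g)$ is the saturation of $J(g)$ with respect to the ideal $(y_1,y_2,y_3)$. Let $d_1\le d_2$ be nonnegative integers, and suppose that the reduced curve $g=0$ satisfies one of the following two conditions. 1. It is free with exponents $(d_1,d_2)$: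 the $R$-module $\mathrm{Syz}(g)$ is free, with a basis of two homogeneous elements of degrees $d_1$ and $d_2$. 2. It is nearly free with exponents $(d_1,d_2)$: one has $N(g)\neq 0$ and $\dim_{\mathbb{C}} N(g)_j\le 1$ for all $j$, and $\mathrm{Syz}(g)$ has a minimal system of homogeneous generators consisting of three elements, of degrees $d_1,d_2,d_2$. Then for every integer $k\le d+d_1-3$ the multiplication map $$\ell: M(f)_k\to M(f)_{k+1}$$ is injective. -/

import Mathlib

namespace JacobianLefschetz

open MvPolynomial

/-- The Jacobian ideal `J(f)`, generated by all first order partial derivatives of `f`. -/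
noncomputable def jacobianIdeal {n : ℕ} (f : MvPolynomial (Fin n) ℂ) :
    Ideal (MvPolynomial (Fin n) ℂ) :=
  Ideal.span (Set.range fun i => pderiv i f)

/-- The Jacobian (Milnor) algebra `M(f) = S / J(f)`. -/
abbrev MilnorAlgebra {n : ℕ} (f : MvPolynomial (Fin n) ℂ) : Type :=
  MvPolynomial (Fin n) ℂ ⧸ jacobianIdeal f

/-- The degree `k` piece `M(f)_k` of the Jacobian algebra: the classes of the homogeneous
polynomials of degree `k`. -/
noncomputable def milnorPiece {n : ℕ} (f : MvPolynomial (Fin n) ℂ) (k : ℕ) :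
    Submodule ℂ (MilnorAlgebra f) :=
  (homogeneousSubmodule (Fin n) ℂ k).map (Ideal.Quotient.mkₐ ℂ (jacobianIdeal f)).toLinearMap

theorem mul_mem_milnorPiece {n : ℕ} (f l : MvPolynomial (Fin n) ℂ) (hl : l.IsHomogeneous 1)
    (k : ℕ) : ∀ m ∈ milnorPiece f k,
      LinearMap.mulLeft ℂ (Ideal.Quotient.mk (jacobianIdeal f) l) m ∈ milnorPiece f (k + 1) := by
  rintro _ ⟨q, hq, rfl⟩
  refine ⟨l * q, ?_, ?_⟩
  · have h := hl.mul ((mem_homogeneousSubmodule k q).1 hq)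
    rw [add_comm] at h
    exact (mem_homogeneousSubmodule (k + 1) (l * q)).2 h
  · simp

/-- Multiplication by the linear form `l`, as a linear map `M(f)_k → M(f)_{k+1}`. -/
noncomputable def mulByLinearForm {n : ℕ} (f l : MvPolynomial (Fin n) ℂ)
    (hl : l.IsHomogeneous 1) (k : ℕ) : milnorPiece f k →ₗ[ℂ] milnorPiece f (k + 1) :=
  (LinearMap.mulLeft ℂ (Ideal.Quotient.mk (jacobianIdeal f) l)).restrict
    (mul_mem_milnorPiece f l hl k)

/-- The zero set of a homogeneous polynomial `f` in `n` variables in the projective space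
`ℙ(ℂⁿ)`. For homogeneous `f` the condition does not depend on the representative. -/
def projectiveZeros {n : ℕ} (f : MvPolynomial (Fin n) ℂ) :
    Set (Projectivization ℂ (Fin n → ℂ)) :=
  {p | eval p.rep f = 0}

/-- The singular locus of the projective hypersurface `f = 0`: the points of the hypersurface at
which all partial derivatives of `f` vanish. -/
def singularLocus {n : ℕ} (f : MvPolynomial (Fin n) ℂ) :
    Set (Projectivization ℂ (Fin n → ℂ)) :=
  {p | p ∈ projectiveZeros f ∧ ∀ i, p ∈ projectiveZeros (pderiv i f)}

/-- A hypersurface has isolated singularities if its singular locus is finite (possibly empty). -/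
def HasIsolatedSingularities {n : ℕ} (f : MvPolynomial (Fin n) ℂ) : Prop :=
  (singularLocus f).Finite

/-- The columns of the matrix `A` form a basis of the plane `l = 0`, viewed as a linear subspace of
`ℂ⁴`; equivalently `y ↦ A y` is a system of linear coordinates `y` on the projective plane
`H : l = 0` in `ℙ³`. -/
def IsCoordinateSystem (l : MvPolynomial (Fin 4) ℂ) (A : Matrix (Fin 4) (Fin 3) ℂ) : Prop :=
  Function.Injective A.mulVec ∧ Set.range A.mulVec = {v | eval v l = 0}

/-- The restriction `g(y) = f(A y)` of `f` to the plane parametrized by `A`. -/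
noncomputable def restrictToPlane (f : MvPolynomial (Fin 4) ℂ) (A : Matrix (Fin 4) (Fin 3) ℂ) :
    MvPolynomial (Fin 3) ℂ :=
  aeval (fun i => ∑ j, C (A i j) * X j) f

/-- The saturation `I(g)` of the Jacobian ideal `J(g)` with respect to the maximal ideal
`m` generated by the variables: all `c` with `m ^ N * c ⊆ J(g)` for some `N`. -/
noncomputable def saturatedJacobianIdeal {n : ℕ} (g : MvPolynomial (Fin n) ℂ) :
    Ideal (MvPolynomial (Fin n) ℂ) where
  carrier := {c | ∃ N : ℕ, ∀ b ∈ (Ideal.span (Set.range X) : Ideal (MvPolynomial (Fin n) ℂ)) ^ N,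
    b * c ∈ jacobianIdeal g}
  zero_mem' := ⟨0, fun b _ => by simp⟩
  add_mem' := by
    rintro c c' ⟨N, hN⟩ ⟨N', hN'⟩
    refine ⟨max N N', fun b hb => ?_⟩
    rw [mul_add]
    exact add_mem (hN b (Ideal.pow_le_pow_right (le_max_left N N') hb))
      (hN' b (Ideal.pow_le_pow_right (le_max_right N N') hb))
  smul_mem' := by
    rintro a c ⟨N, hN⟩
    refine ⟨N, fun b hb => ?_⟩
    rw [smul_eq_mul, mul_left_comm]
    exact Ideal.mul_mem_left _ a (hN b hb)

/-- The degree `k` piece `N(g)_k` of the Jacobian module `N(g) = I(g) / J(g) ⊆ M(g)`. -/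
noncomputable def jacobianModulePiece {n : ℕ} (g : MvPolynomial (Fin n) ℂ) (k : ℕ) :
    Submodule ℂ (MilnorAlgebra g) :=
  ((saturatedJacobianIdeal g).restrictScalars ℂ ⊓ homogeneousSubmodule (Fin n) ℂ k).map
    (Ideal.Quotient.mkₐ ℂ (jacobianIdeal g)).toLinearMap

/-- The module `Syz(g)` of first order syzygies `a` of the partial derivatives of `g`, that is
`∑ i, a i * ∂g/∂yᵢ = 0`. -/
noncomputable def syzygyModule {n : ℕ} (g : MvPolynomial (Fin n) ℂ) :
    Submodule (MvPolynomial (Fin n) ℂ) (Fin n → MvPolynomial (Fin n) ℂ) where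
  carrier := {a | ∑ i, a i * pderiv i g = 0}
  zero_mem' := by simp
  add_mem' := by
    intro a b ha hb
    simp only [Set.mem_ofPred_eq] at ha hb ⊢
    simp [add_mul, Finset.sum_add_distrib, ha, hb]
  smul_mem' := by
    intro c a ha
    simp only [Set.mem_ofPred_eq] at ha ⊢
    simp [mul_assoc, ← Finset.mul_sum, ha]

/-- A tuple of polynomials is homogeneous of degree `k` if all its entries are. -/
def IsHomogeneousTuple {n : ℕ} (a : Fin n → MvPolynomial (Fin n) ℂ) (k : ℕ) : Prop :=
  ∀ i, (a i).IsHomogeneous k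

/-- The reduced plane curve `g = 0` is free with exponents `(d₁, d₂)`: the graded module `Syz(g)`
is free, with a basis of two homogeneous elements of degrees `d₁` and `d₂`. -/
def IsFreeCurve (g : MvPolynomial (Fin 3) ℂ) (d₁ d₂ : ℕ) : Prop :=
  Squarefree g ∧
  ∃ b : Module.Basis (Fin 2) (MvPolynomial (Fin 3) ℂ) (syzygyModule g),
    IsHomogeneousTuple (b 0 : Fin 3 → MvPolynomial (Fin 3) ℂ) d₁ ∧
    IsHomogeneousTuple (b 1 : Fin 3 → MvPolynomial (Fin 3) ℂ) d₂

/-- The reduced plane curve `g = 0` is nearly free: `N(g) ≠ 0`, and every graded piece of `N(g)`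
has dimension at most one. -/
def IsNearlyFreeCurve (g : MvPolynomial (Fin 3) ℂ) : Prop :=
  Squarefree g ∧ saturatedJacobianIdeal g ≠ jacobianIdeal g ∧
  ∀ k, Module.rank ℂ (jacobianModulePiece g k) ≤ 1

/-- The exponents `(d₁, d₂)` of a nearly free curve: the graded module `Syz(g)` has a minimal
system of homogeneous generators consisting of three elements, of degrees `d₁`, `d₂`, `d₂`. -/
def HasNearlyFreeExponents (g : MvPolynomial (Fin 3) ℂ) (d₁ d₂ : ℕ) : Prop :=
  ∃ ρ : Fin 3 → Fin 3 → MvPolynomial (Fin 3) ℂ,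
    Submodule.span (MvPolynomial (Fin 3) ℂ) (Set.range ρ) = syzygyModule g ∧
    (∀ i, ρ i ∉ Submodule.span (MvPolynomial (Fin 3) ℂ) (ρ '' {j | j ≠ i})) ∧
    IsHomogeneousTuple (ρ 0) d₁ ∧ IsHomogeneousTuple (ρ 1) d₂ ∧ IsHomogeneousTuple (ρ 2) d₂

end JacobianLefschetz

/-
Let `l = ∑ mᵢ xᵢ`, let `Fᵢ` be the restriction of `∂f/∂xᵢ` to the plane `l = 0`, and let `g` be the
restriction of `f`. If `l q = ∑ aᵢ ∂f/∂xᵢ`, then the restrictions of the `aᵢ` form a relation among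
the `Fᵢ`; as soon as that relation vanishes, `l` divides every `aᵢ` and `q` lies in `J(f)`.

So let `∑ aᵢ Fᵢ = 0` with `aᵢ` of degree `e < d₁`. The form `u = ∑ mᵢ aᵢ` multiplies every `Fᵢ` into
`J(g)`, and the `Fᵢ` have no common zero, because the plane contains no singular point of `f`.
Hence `u ∈ I(g)`, and it suffices to show `u = 0`: then `a = A b` for a syzygy `b` of `g` of degree
`e < d₁`, so `b = 0`. As `dim N(g)_{e+1} ≤ 1`, two independent linear forms `p, p'` satisfy
`p u, p' u ∈ J(g)`. If `e + 1 < d - 1`, these products vanish for degree reasons. If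
`e + 1 = d - 1`, eliminating `u` gives a syzygy of `g` of degree `1 ≤ e < d₁`, which vanishes and
forces `p u = 0`. If `e ≥ d - 1`, the Koszul syzygies of `g` vanish as well, so `J(g) = 0` and
`u = 0`.

If `g` is free then `N(g) = 0`, since a quotient of a free module of rank three by a free submodule
has depth at least two.
-/

namespace JacobianLefschetz

open MvPolynomial Matrix RingTheory.Sequence

section Homogeneous

variable {σ K ι : Type*} [CommSemiring K]

theorem coe_decompose_eq_homogeneousComponent (p : MvPolynomial σ K) (n : ℕ) :
    letI := gradedAlgebra (σ := σ) (R := K)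
    (DirectSum.decompose (homogeneousSubmodule σ K) p n : MvPolynomial σ K) =
      homogeneousComponent n p :=
  decomposition.decompose'_apply p n

theorem homogeneousComponent_add_mul {p : MvPolynomial σ K} {i : ℕ} (hp : p.IsHomogeneous i)
    (j : ℕ) (q : MvPolynomial σ K) :
    homogeneousComponent (i + j) (p * q) = p * homogeneousComponent j q := by
  classical
  let _ := gradedAlgebra (σ := σ) (R := K)
  simpa only [coe_decompose_eq_homogeneousComponent] using
    DirectSum.coe_decompose_mul_add_of_left_mem (homogeneousSubmodule σ K) (j := j) (b := q) hp

theorem homogeneousComponent_mul_of_lt {p : MvPolynomial σ K} {i n : ℕ} (hp : p.IsHomogeneous i)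
    (h : n < i) (q : MvPolynomial σ K) : homogeneousComponent n (p * q) = 0 := by
  classical
  let _ := gradedAlgebra (σ := σ) (R := K)
  simpa only [coe_decompose_eq_homogeneousComponent] using
    DirectSum.coe_decompose_mul_of_left_mem_of_not_le (homogeneousSubmodule σ K) (b := q) hp
      h.not_ge

variable {G : ι → MvPolynomial σ K} {p : MvPolynomial σ K}

theorem exists_isHomogeneous_of_mem_span [Fintype ι] {m j : ℕ} (hG : ∀ i, (G i).IsHomogeneous m)
    (hp : p.IsHomogeneous (m + j)) (h : p ∈ Ideal.span (Set.range G)) :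
    ∃ a : ι → MvPolynomial σ K, (∀ i, (a i).IsHomogeneous j) ∧ ∑ i, a i * G i = p := by
  obtain ⟨a, rfl⟩ := Ideal.mem_span_range_iff_exists_fun.1 h
  refine ⟨fun i => homogeneousComponent j (a i),
    fun i => homogeneousComponent_isHomogeneous j (a i), ?_⟩
  rw [← homogeneousComponent_eq_self hp, map_sum]
  refine Finset.sum_congr rfl fun i _ => ?_
  rw [mul_comm (a i), homogeneousComponent_add_mul (hG i), mul_comm]

theorem eq_zero_of_mem_span_of_lt {D : ι → ℕ} {k : ℕ} (hG : ∀ i, (G i).IsHomogeneous (D i))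
    (hk : ∀ i, k < D i) (hp : p.IsHomogeneous k) (h : p ∈ Ideal.span (Set.range G)) : p = 0 := by
  obtain ⟨a, rfl⟩ := Finsupp.mem_ideal_span_range_iff_exists_finsupp.1 h
  rw [← homogeneousComponent_eq_self hp, map_finsuppSum]
  refine Finset.sum_eq_zero fun i _ => ?_
  change homogeneousComponent k (a i * G i) = 0
  rw [mul_comm, homogeneousComponent_mul_of_lt (hG i) (hk i)]

end Homogeneous

section LinearForms

variable {σ K : Type*}

theorem exists_eq_sum_C_mul_X [Fintype σ] [CommSemiring K] {l : MvPolynomial σ K}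
    (hl : l.IsHomogeneous 1) : ∃ m : σ → K, l = ∑ i, C (m i) * X i := by
  have h := (mem_homogeneousSubmodule 1 l).2 hl
  rw [homogeneousSubmodule_one_eq_span_X, Submodule.mem_span_range_iff_exists_fun] at h
  obtain ⟨m, hm⟩ := h
  exact ⟨m, by simp_rw [← hm, smul_eq_C_mul]⟩

theorem finrank_homogeneousSubmodule_one [Fintype σ] [Field K] :
    Module.finrank K (homogeneousSubmodule σ K 1) = Fintype.card σ := by
  rw [homogeneousSubmodule_one_eq_span_X, finrank_span_eq_card (linearIndependent_X σ K)]

theorem prime_of_isHomogeneous_one [Field K] {l : MvPolynomial σ K} (hl : l.IsHomogeneous 1)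
    (hl0 : l ≠ 0) : Prime l := by
  obtain ⟨s, hs⟩ := ne_zero_iff.1 hl0
  exact (irreducible_of_totalDegree_eq_one (hl.totalDegree hl0) fun c hc =>
    (ne_zero_of_dvd_ne_zero hs (hc s)).isUnit).prime

theorem eval_smul_of_isHomogeneous [CommSemiring K] {f : MvPolynomial σ K}
    {n : ℕ} (hf : f.IsHomogeneous n) (c : K) (x : σ → K) : eval (c • x) f = c ^ n * eval x f := by
  rw [eval_eq, eval_eq, Finset.mul_sum]
  refine Finset.sum_congr rfl fun m hm => ?_
  rw [hf.degree_eq_sum_deg_support hm]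
  simp only [Pi.smul_apply, smul_eq_mul, mul_pow, Finset.prod_mul_distrib,
    Finset.prod_pow_eq_pow_sum]
  ring

theorem pderiv_aeval {τ : Type*} [Fintype σ] [CommRing K] (φ : σ → MvPolynomial τ K)
    (f : MvPolynomial σ K) (j : τ) :
    pderiv j (aeval φ f) = ∑ i, aeval φ (pderiv i f) * pderiv j (φ i) := by
  classical
  induction f using MvPolynomial.induction_on with
  | C a => simp
  | add p q hp hq => simp only [map_add, hp, hq, add_mul, Finset.sum_add_distrib]
  | mul_X p i hp =>
    simp only [map_mul, aeval_X, pderiv_mul, hp, map_add, add_mul, Finset.sum_add_distrib,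
      Finset.sum_mul, pderiv_X]
    congr 1
    · exact Finset.sum_congr rfl fun _ _ => by ring
    · rw [Finset.sum_eq_single i]
      · simp
      · intro b _ hb
        simp [hb.symm]
      · simp

end LinearForms

section RegularSequence

theorem isWeaklyRegular_of_flat {R M : Type*} [CommRing R] [AddCommGroup M] [Module R M]
    [Module.Flat R M] {rs : List R} (h : IsWeaklyRegular R rs) : IsWeaklyRegular M rs :=
  ((TensorProduct.rid R M).isWeaklyRegular_congr rs).1 h.isWeaklyRegular_lTensor

theorem mem_span_X_pow_of_X_pow_mul_mem {σ K : Type*} [CommSemiring K] {s : Set σ} {i : σ}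
    (hi : i ∉ s) {N : ℕ} {p : MvPolynomial σ K}
    (h : X i ^ N * p ∈ Ideal.span ((fun j => (X j : MvPolynomial σ K) ^ N) '' s)) :
    p ∈ Ideal.span ((fun j => (X j : MvPolynomial σ K) ^ N) '' s) := by
  have hs : (fun j => (X j : MvPolynomial σ K) ^ N) '' s =
      (fun m => monomial m 1) '' ((fun j => Finsupp.single j N) '' s) := by
    simp only [Set.image_image, X_pow_eq_monomial]
  rw [hs, mem_ideal_span_monomial_image] at h ⊢
  intro m hm
  obtain ⟨_, ⟨j, hj, rfl⟩, hle⟩ := h (Finsupp.single i N + m) (by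
    rwa [mem_support_iff, X_pow_eq_monomial, coeff_monomial_mul, one_mul, ← mem_support_iff])
  refine ⟨_, ⟨j, hj, rfl⟩, ?_⟩
  rw [Finsupp.single_le_iff] at hle ⊢
  rwa [Finsupp.add_apply, Finsupp.single_eq_of_ne (ne_of_mem_of_not_mem hj hi), zero_add] at hle

theorem isWeaklyRegular_X_pow {σ K : Type*} [CommRing K] (N : ℕ) {vs : List σ} (hvs : vs.Nodup) :
    IsWeaklyRegular (MvPolynomial σ K) (vs.map fun v => (X v : MvPolynomial σ K) ^ N) := by
  refine (isWeaklyRegular_iff _ _).2 fun i hi => ?_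
  rw [List.length_map] at hi
  have htake : Ideal.ofList ((vs.map fun v => (X v : MvPolynomial σ K) ^ N).take i) =
      Ideal.span ((fun v => (X v : MvPolynomial σ K) ^ N) '' {v | v ∈ vs.take i}) := by
    rw [← List.map_take]
    exact congrArg Ideal.span (Set.ext fun p => List.mem_map)
  have hnotMem : vs[i] ∉ vs.take i := by
    rw [List.mem_take_iff_getElem]
    rintro ⟨j, hj, hji⟩
    have := (hvs.getElem_inj_iff).1 hji
    omega
  rw [smul_eq_mul, Ideal.mul_top, isSMulRegular_quotient_iff_mem_of_smul_mem, htake,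
    List.getElem_map]
  exact fun p => mem_span_X_pow_of_X_pow_mul_mem (s := {v | v ∈ vs.take i}) hnotMem

variable {R M P : Type*} [CommRing R] [AddCommGroup M] [Module R M] [AddCommGroup P] [Module R P]
  {x y z : R}

theorem exists_eq_smul_of_smul_eq_smul (h : IsWeaklyRegular M [x, y]) {a b : M}
    (hab : y • a = x • b) : ∃ c, a = x • c := by
  have ha : a ∈ (Ideal.ofList [x] • ⊤ : Submodule R M) := by
    refine (isSMulRegular_quotient_iff_mem_of_smul_mem _ y).1 (h.regular_mod_prev 1 (by simp)) a ?_
    rw [hab]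
    exact Submodule.smul_mem_smul (Ideal.subset_span (by simp)) trivial
  rw [Ideal.ofList_singleton, Submodule.ideal_span_singleton_smul] at ha
  obtain ⟨c, -, hc⟩ := ha
  exact ⟨c, hc.symm⟩

theorem exists_eq_smul_add_smul_of_smul_eq (h : IsWeaklyRegular M [x, y, z]) {a b c : M}
    (habc : z • a = x • b + y • c) : ∃ b' c', a = x • b' + y • c' := by
  have ha : a ∈ (Ideal.ofList [x, y] • ⊤ : Submodule R M) := by
    refine (isSMulRegular_quotient_iff_mem_of_smul_mem _ z).1 (h.regular_mod_prev 2 (by simp)) a ?_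
    rw [habc]
    exact add_mem (Submodule.smul_mem_smul (Ideal.subset_span (by simp)) trivial)
      (Submodule.smul_mem_smul (Ideal.subset_span (by simp)) trivial)
  rw [Ideal.ofList_cons_smul, Ideal.ofList_singleton, Submodule.ideal_span_singleton_smul] at ha
  obtain ⟨_, ⟨b', -, rfl⟩, _, ⟨c', -, rfl⟩, h⟩ := Submodule.mem_sup.1 ha
  exact ⟨b', c', h.symm⟩

-- The depth count `depth (M ⧸ K) ≥ 2`, `K = ker φ`, made explicit: the lifts `a, b, c` of
-- `x • u, y • u, z • u` are corrected by elements of `K` until the first one is divisible by `x`.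
theorem mem_range_of_isWeaklyRegular_ker {φ : M →ₗ[R] P} (hP : IsSMulRegular P x)
    (hM : IsWeaklyRegular M [x, y]) (hK : IsWeaklyRegular (LinearMap.ker φ) [x, y, z]) {u : P}
    (hx : x • u ∈ LinearMap.range φ) (hy : y • u ∈ LinearMap.range φ)
    (hz : z • u ∈ LinearMap.range φ) : u ∈ LinearMap.range φ := by
  obtain ⟨a, ha⟩ := hx
  obtain ⟨b, hb⟩ := hy
  obtain ⟨c, hc⟩ := hz
  let κ₁ : LinearMap.ker φ := ⟨y • a - x • b, by simp [ha, hb, smul_comm x y]⟩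
  let κ₂ : LinearMap.ker φ := ⟨z • a - x • c, by simp [ha, hc, smul_comm x z]⟩
  let κ₃ : LinearMap.ker φ := ⟨y • c - z • b, by simp [hb, hc, smul_comm y z]⟩
  have hκ : z • κ₁ = x • κ₃ + y • κ₂ := Subtype.ext (by
    change z • (y • a - x • b) = x • (y • c - z • b) + y • (z • a - x • c)
    module)
  obtain ⟨α, β, hαβ⟩ := exists_eq_smul_add_smul_of_smul_eq hK hκ
  have hαβ' : y • a - x • b = x • (α : M) + y • (β : M) := congrArg Subtype.val hαβ
  obtain ⟨θ, hθ⟩ := exists_eq_smul_of_smul_eq_smul hM (a := a - β) (b := b + α) (by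
    rw [smul_sub, smul_add, sub_eq_iff_eq_add, add_assoc, ← hαβ', add_sub_cancel])
  refine ⟨θ, hP ?_⟩
  change x • φ θ = x • u
  rw [← ha, ← map_smul, ← hθ, map_sub, LinearMap.mem_ker.1 β.2, sub_zero]

end RegularSequence

section Jacobian

variable {n : ℕ} {g u : MvPolynomial (Fin n) ℂ}

theorem mem_saturatedJacobianIdeal_iff :
    u ∈ saturatedJacobianIdeal g ↔ ∃ N : ℕ, ∀ v, X v ^ N * u ∈ jacobianIdeal g := by
  refine ⟨fun ⟨N, hN⟩ => ⟨N, fun v => hN _ (Ideal.pow_mem_pow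
    (Ideal.subset_span (Set.mem_range_self v)) N)⟩, fun ⟨N, hN⟩ => ?_⟩
  have hle : (Ideal.span (Set.range X) : Ideal (MvPolynomial (Fin n) ℂ)) ≤
      ((jacobianIdeal g).colon {u}).radical := by
    rw [Ideal.span_le]
    rintro _ ⟨v, rfl⟩
    exact ⟨N, Submodule.mem_colon_singleton.2 (hN v)⟩
  obtain ⟨M, hM⟩ := Ideal.exists_pow_le_of_le_radical_of_fg hle (Ideal.fg_of_isNoetherianRing _)
  exact ⟨M, fun b hb => Submodule.mem_colon_singleton.1 (hM hb)⟩

theorem mul_mem_jacobianIdeal_of_mem_span {ι : Type*} {F : ι → MvPolynomial (Fin n) ℂ}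
    (hF : ∀ i, u * F i ∈ jacobianIdeal g) {p : MvPolynomial (Fin n) ℂ}
    (hp : p ∈ Ideal.span (Set.range F)) : p * u ∈ jacobianIdeal g := by
  have hle : Ideal.span (Set.range F) ≤ (jacobianIdeal g).colon {u} := by
    rw [Ideal.span_le]
    rintro _ ⟨i, rfl⟩
    rw [SetLike.mem_coe, Submodule.mem_colon_singleton, smul_eq_mul, mul_comm]
    exact hF i
  exact Submodule.mem_colon_singleton.1 (hle hp)

theorem ker_linearCombination_pderiv :
    LinearMap.ker (Fintype.linearCombination (MvPolynomial (Fin n) ℂ) fun i => pderiv i g) =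
      syzygyModule g := by
  ext a
  exact Iff.of_eq (congrArg (· = 0) (Fintype.linearCombination_apply _ _ a))

theorem range_linearCombination_pderiv :
    LinearMap.range (Fintype.linearCombination (MvPolynomial (Fin n) ℂ) fun i => pderiv i g) =
      jacobianIdeal g :=
  Fintype.range_linearCombination _ _

theorem saturatedJacobianIdeal_eq_of_flat [Module.Flat (MvPolynomial (Fin n) ℂ) (syzygyModule g)]
    (hn : 3 ≤ n) : saturatedJacobianIdeal g = jacobianIdeal g := by
  refine le_antisymm (fun u hu => ?_) fun u hu => ⟨0, fun b _ => Ideal.mul_mem_left _ b hu⟩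
  obtain ⟨N, hN⟩ := mem_saturatedJacobianIdeal_iff.1 hu
  let v : Fin 3 ↪ Fin n := Fin.castLEEmb hn
  have hreg₂ : IsWeaklyRegular (MvPolynomial (Fin n) ℂ) [X (v 0) ^ N, X (v 1) ^ N] :=
    isWeaklyRegular_X_pow N (vs := [v 0, v 1]) (by simp)
  have hreg₃ : IsWeaklyRegular (MvPolynomial (Fin n) ℂ)
      [X (v 0) ^ N, X (v 1) ^ N, X (v 2) ^ N] :=
    isWeaklyRegular_X_pow N (vs := [v 0, v 1, v 2]) (by simp)
  have hflat : Module.Flat (MvPolynomial (Fin n) ℂ) (LinearMap.ker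
      (Fintype.linearCombination (MvPolynomial (Fin n) ℂ) fun i => pderiv i g)) := by
    rwa [ker_linearCombination_pderiv]
  rw [← range_linearCombination_pderiv] at hN ⊢
  exact mem_range_of_isWeaklyRegular_ker ((isWeaklyRegular_cons_iff _ _ _).1 hreg₂).1
    (isWeaklyRegular_of_flat hreg₂) (isWeaklyRegular_of_flat hreg₃) (hN (v 0)) (hN (v 1)) (hN (v 2))

theorem jacobianModulePiece_eq_bot (h : saturatedJacobianIdeal g = jacobianIdeal g) (k : ℕ) :
    jacobianModulePiece g k = ⊥ := by
  rw [eq_bot_iff]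
  rintro _ ⟨u, ⟨hu, -⟩, rfl⟩
  exact Ideal.Quotient.eq_zero_iff_mem.2 (h ▸ hu)

/-- The nonzero homogeneous syzygies among the partial derivatives of `g` have degree at least `r`,
i.e. `mdr(g) ≥ r` for the minimal degree `mdr(g)` of a Jacobian relation. -/
def SyzygiesVanishBelow (g : MvPolynomial (Fin n) ℂ) (r : ℕ) : Prop :=
  ∀ j < r, ∀ a ∈ syzygyModule g, IsHomogeneousTuple a j → a = 0

theorem syzygiesVanishBelow_of_span_eq {ι : Type*}
    {ρ : ι → Fin n → MvPolynomial (Fin n) ℂ} {D : ι → ℕ} {r : ℕ}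
    (hρ : Submodule.span (MvPolynomial (Fin n) ℂ) (Set.range ρ) = syzygyModule g)
    (hD : ∀ i, IsHomogeneousTuple (ρ i) (D i)) (hr : ∀ i, r ≤ D i) : SyzygiesVanishBelow g r := by
  intro j hj a ha haj
  funext v
  have hav := Submodule.mem_map_of_mem (f := LinearMap.proj v) (hρ.symm ▸ ha)
  rw [Submodule.map_span, ← Set.range_comp] at hav
  exact eq_zero_of_mem_span_of_lt (fun i => hD i v) (fun i => hj.trans_le (hr i)) (haj v) hav

theorem mul_sub_mul_mem_syzygyModule {p q : MvPolynomial (Fin n) ℂ}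
    {a b : Fin n → MvPolynomial (Fin n) ℂ} (ha : ∑ i, a i * pderiv i g = p * u)
    (hb : ∑ i, b i * pderiv i g = q * u) : q • a - p • b ∈ syzygyModule g := by
  change ∑ i, (q * a i - p * b i) * pderiv i g = 0
  simp only [sub_mul, mul_assoc, Finset.sum_sub_distrib, ← Finset.mul_sum, ha, hb]
  ring

theorem SyzygiesVanishBelow.pderiv_eq_zero {d r : ℕ} (hr : SyzygiesVanishBelow g r)
    (hg : g.IsHomogeneous d) (hd : d - 1 < r) (hn : 2 ≤ n) (i : Fin n) : pderiv i g = 0 := by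
  have : Nontrivial (Fin n) := Fin.nontrivial_iff_two_le.2 hn
  obtain ⟨j, hji⟩ := exists_ne i
  let δ (k : Fin n) : Fin n → MvPolynomial (Fin n) ℂ := Pi.single k 1
  have hδ (k : Fin n) : ∑ v, δ k v * pderiv v g = pderiv k g * 1 := by
    simp [δ, Pi.single_apply]
  have hδ₀ (k v : Fin n) : (δ k v).IsHomogeneous 0 := by
    simp only [δ, Pi.single_apply]
    split_ifs
    exacts [isHomogeneous_one _ _, isHomogeneous_zero _ _ _]
  have hkoszul := hr (d - 1) hd _ (mul_sub_mul_mem_syzygyModule (hδ j) (hδ i))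
    fun v => (hg.pderiv.mul (hδ₀ j v)).sub (hg.pderiv.mul (hδ₀ i v))
  simpa [δ, hji.symm] using congrFun hkoszul j

theorem SyzygiesVanishBelow.jacobianIdeal_eq_bot {d r : ℕ} (hr : SyzygiesVanishBelow g r)
    (hg : g.IsHomogeneous d) (hd : d - 1 < r) (hn : 2 ≤ n) : jacobianIdeal g = ⊥ := by
  rw [jacobianIdeal, Ideal.span_eq_bot]
  rintro _ ⟨i, rfl⟩
  exact hr.pderiv_eq_zero hg hd hn i

theorem exists_linearIndependent_mul_mem_jacobianIdeal {e : ℕ}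
    (hN : Module.rank ℂ (jacobianModulePiece g (e + 1)) + 2 ≤ n)
    (hu : u ∈ saturatedJacobianIdeal g) (he : u.IsHomogeneous e) :
    ∃ p q : MvPolynomial (Fin n) ℂ, LinearIndependent ℂ ![p, q] ∧
      (p.IsHomogeneous 1 ∧ p * u ∈ jacobianIdeal g) ∧
        (q.IsHomogeneous 1 ∧ q * u ∈ jacobianIdeal g) := by
  have hmem (p : homogeneousSubmodule (Fin n) ℂ 1) :
      Ideal.Quotient.mk (jacobianIdeal g) (p * u) ∈ jacobianModulePiece g (e + 1) :=
    ⟨p * u, ⟨Ideal.mul_mem_left _ _ hu, add_comm 1 e ▸ p.2.mul he⟩, rfl⟩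
  let φ : homogeneousSubmodule (Fin n) ℂ 1 →ₗ[ℂ] jacobianModulePiece g (e + 1) :=
    LinearMap.codRestrict _ ((Ideal.Quotient.mkₐ ℂ (jacobianIdeal g)).toLinearMap ∘ₗ
      LinearMap.mulRight ℂ u ∘ₗ Submodule.subtype _) hmem
  have hφ (p : LinearMap.ker φ) : (p : MvPolynomial (Fin n) ℂ) * u ∈ jacobianIdeal g :=
    Ideal.Quotient.eq_zero_iff_mem.1 (congrArg Subtype.val (LinearMap.mem_ker.1 p.2))
  have : Module.Finite ℂ (homogeneousSubmodule (Fin n) ℂ 1) := by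
    rw [homogeneousSubmodule_one_eq_span_X]
    exact Module.Finite.span_of_finite ℂ (Set.finite_range _)
  have hrange : Module.finrank ℂ (LinearMap.range φ) + 2 ≤ n := by
    have h := (add_le_add_left (Submodule.rank_le (LinearMap.range φ)) 2).trans hN
    rw [← Module.finrank_eq_rank] at h
    exact_mod_cast h
  have hker : 1 < Module.finrank ℂ (LinearMap.ker φ) := by
    have := φ.finrank_range_add_finrank_ker
    rw [finrank_homogeneousSubmodule_one, Fintype.card_fin] at this
    omega
  have := Module.nontrivial_of_finrank_pos (zero_lt_one.trans hker)
  obtain ⟨p, hp0⟩ := exists_ne (0 : LinearMap.ker φ)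
  obtain ⟨q, hpq⟩ :=
    exists_linearIndependent_pair_of_one_lt_finrank (M := LinearMap.ker φ) hker hp0
  exact ⟨p, q, LinearIndependent.pair_iff.2 fun s t h =>
    LinearIndependent.pair_iff.1 hpq s t (Subtype.ext (Subtype.ext h)),
    ⟨p.1.2, hφ p⟩, q.1.2, hφ q⟩

theorem SyzygiesVanishBelow.eq_zero_of_mem_saturatedJacobianIdeal {d e r : ℕ}
    (hr : SyzygiesVanishBelow g r) (hg : g.IsHomogeneous d) (hd : 3 ≤ d)
    (hN : Module.rank ℂ (jacobianModulePiece g (e + 1)) + 2 ≤ n)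
    (hu : u ∈ saturatedJacobianIdeal g) (hue : u.IsHomogeneous e) (her : e < r) : u = 0 := by
  have hn : 2 ≤ n := by exact_mod_cast le_add_self.trans hN
  rcases le_or_gt (d - 1) e with hde | hde
  · obtain ⟨N, hN⟩ := mem_saturatedJacobianIdeal_iff.1 hu
    have hXu := hN ⟨0, by omega⟩
    rw [hr.jacobianIdeal_eq_bot hg (by omega) hn, Ideal.mem_bot] at hXu
    exact (mul_eq_zero.1 hXu).resolve_left (pow_ne_zero _ (X_ne_zero _))
  obtain ⟨p, q, hpq, ⟨hp, hpu⟩, hq, hqu⟩ :=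
    exists_linearIndependent_mul_mem_jacobianIdeal hN hu hue
  suffices hpu₀ : p * u = 0 from (mul_eq_zero.1 hpu₀).resolve_left (hpq.ne_zero 0)
  rcases (Nat.succ_le_of_lt hde).lt_or_eq with hlt | heq
  · exact eq_zero_of_mem_span_of_lt (fun _ => hg.pderiv)
      (fun _ => (add_comm 1 e).trans_lt hlt) (hp.mul hue) hpu
  have hdeg : 1 + e = d - 1 + 0 := by omega
  obtain ⟨a, ha, hap⟩ := exists_isHomogeneous_of_mem_span (fun _ => hg.pderiv)
    (hdeg ▸ hp.mul hue) hpu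
  obtain ⟨b, hb, hbq⟩ := exists_isHomogeneous_of_mem_span (fun _ => hg.pderiv)
    (hdeg ▸ hq.mul hue) hqu
  have hab : q • a - p • b = 0 := hr 1 (by omega) _ (mul_sub_mul_mem_syzygyModule hap hbq)
    fun v => (hq.mul (ha v)).sub (hp.mul (hb v))
  have hconst {c : MvPolynomial (Fin n) ℂ} (hc : c.IsHomogeneous 0) : c = C (coeff 0 c) := by
    rw [← homogeneousComponent_zero, homogeneousComponent_eq_self hc]
  have ha₀ (v : Fin n) : a v = 0 := by
    have hv : q * a v - p * b v = 0 := congrFun hab v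
    rw [hconst (ha v), hconst (hb v)] at hv
    have hcoeff := LinearIndependent.pair_iff.1 hpq (-coeff 0 (b v)) (coeff 0 (a v)) (by
      rw [smul_eq_C_mul, smul_eq_C_mul, C_neg]
      linear_combination hv)
    rw [hconst (ha v), hcoeff.2, C_0]
  simp only [← hap, ha₀, zero_mul, Finset.sum_const_zero]

end Jacobian

section LinearSubstitution

variable {σ τ K : Type*} [Fintype τ] [Field K]

/-- The linear substitution `x = A y`, that is, the restriction of polynomials in `x` to the image
of `A`, which is parametrized by the variables `y`; thus `restrictToPlane f A` is
`linearSubst A f`. -/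
noncomputable def linearSubst (A : Matrix σ τ K) : MvPolynomial σ K →ₐ[K] MvPolynomial τ K :=
  aeval fun i => ∑ j, C (A i j) * X j

theorem isHomogeneous_linearSubst (A : Matrix σ τ K) {p : MvPolynomial σ K} {n : ℕ}
    (hp : p.IsHomogeneous n) : (linearSubst A p).IsHomogeneous n := by
  simpa only [linearSubst, one_mul] using
    hp.aeval (fun i => ∑ j, C (A i j) * X j : σ → MvPolynomial τ K) fun i =>
      IsHomogeneous.sum _ _ _ fun j _ => isHomogeneous_C_mul_X _ _

theorem eval_linearSubst (A : Matrix σ τ K) (p : MvPolynomial σ K) (y : τ → K) :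
    eval y (linearSubst A p) = eval (A *ᵥ y) p := by
  induction p using MvPolynomial.induction_on with
  | C a => simp
  | add p q hp hq => simp only [map_add, hp, hq]
  | mul_X p i hp =>
    have hX : eval y (linearSubst A (X i)) = eval (A *ᵥ y) (X i) := by
      simp [linearSubst, mulVec, dotProduct]
    simp only [map_mul, hp, hX]

theorem pderiv_linearSubst [Fintype σ] (A : Matrix σ τ K) (p : MvPolynomial σ K) (j : τ) :
    pderiv j (linearSubst A p) = ∑ i, C (A i j) * linearSubst A (pderiv i p) := by
  classical
  rw [linearSubst, pderiv_aeval]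
  refine Finset.sum_congr rfl fun i _ => ?_
  rw [map_sum, Finset.sum_eq_single j]
  · simp [mul_comm]
  · intro b _ hb
    simp [pderiv_X_of_ne hb]
  · simp

theorem coeff_map_C_mulVec {ρ : Type*} (N : Matrix σ τ K) (w : τ → MvPolynomial ρ K)
    (s : ρ →₀ ℕ) : (fun i => coeff s ((N.map C *ᵥ w) i)) = N *ᵥ fun j => coeff s (w j) := by
  funext i
  simp only [mulVec, dotProduct, map_apply, coeff_sum, coeff_C_mul]

theorem exists_mulVec_eq_of_sum_eq_zero [Fintype σ] {ρ : Type*} {A : Matrix σ τ K} {m : σ → K}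
    (hinj : Function.Injective A.mulVec) (hrange : Set.range A.mulVec = {x | m ⬝ᵥ x = 0})
    {z : σ → MvPolynomial ρ K} (hz : ∑ i, C (m i) * z i = 0) :
    ∃ b : τ → MvPolynomial ρ K, A.map C *ᵥ b = z ∧
      ∀ e, (∀ i, (z i).IsHomogeneous e) → ∀ j, (b j).IsHomogeneous e := by
  classical
  obtain ⟨B, hB⟩ := A.mulVecLin.exists_leftInverse_of_injective (LinearMap.ker_eq_bot.2 hinj)
  refine ⟨(LinearMap.toMatrix' B).map C *ᵥ z, ?_,
    fun e he j => IsHomogeneous.sum _ _ _ fun i _ => (he i).C_mul _⟩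
  funext i
  ext s
  obtain ⟨y, hy⟩ : (fun i => coeff s (z i)) ∈ Set.range A.mulVec := by
    rw [hrange]
    simpa [dotProduct, coeff_sum, coeff_C_mul] using congrArg (coeff s) hz
  have hBy : B (A *ᵥ y) = y := LinearMap.congr_fun hB y
  refine (congrFun (coeff_map_C_mulVec A _ s) i).trans ?_
  rw [coeff_map_C_mulVec, LinearMap.toMatrix'_mulVec, ← hy, hBy]
  exact congrFun hy i

theorem dvd_of_linearSubst_eq_zero [Finite σ] [IsAlgClosed K] {A : Matrix σ τ K}
    {l p : MvPolynomial σ K} (hl : l.IsHomogeneous 1) (hl0 : l ≠ 0)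
    (hrange : Set.range A.mulVec = {x | eval x l = 0}) (hp : linearSubst A p = 0) : l ∣ p := by
  have hrad : p ∈ (Ideal.span {l}).radical := by
    rw [← vanishingIdeal_zeroLocus_eq_radical (K := K)]
    intro x hx
    obtain ⟨y, rfl⟩ : x ∈ Set.range A.mulVec :=
      hrange ▸ hx l (Ideal.mem_span_singleton_self l)
    rw [aeval_eq_eval, ← eval_linearSubst, hp, map_zero]
  obtain ⟨N, hN⟩ := hrad
  exact (prime_of_isHomogeneous_one hl hl0).dvd_of_dvd_pow (Ideal.mem_span_singleton.1 hN)

end LinearSubstitution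

section Relations

variable {σ : Type*} [Fintype σ] {n : ℕ} {g : MvPolynomial (Fin n) ℂ} {m : σ → ℂ}
  {A : Matrix σ (Fin n) ℂ} {F : σ → MvPolynomial (Fin n) ℂ}

theorem sum_mulVec_mul (hF : ∀ j, pderiv j g = ∑ i, C (A i j) * F i)
    (b : Fin n → MvPolynomial (Fin n) ℂ) :
    ∑ i, (A.map C *ᵥ b) i * F i = ∑ j, b j * pderiv j g := by
  simp only [hF, mulVec, dotProduct, map_apply, Finset.sum_mul, Finset.mul_sum]
  rw [Finset.sum_comm]
  exact Finset.sum_congr rfl fun j _ => Finset.sum_congr rfl fun i _ => by ring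

-- For each `i`, the vector `(m ⬝ᵥ a) eᵢ - mᵢ a` is killed by `m`, hence lies in the image of `A`.
theorem dotProduct_mul_mem_jacobianIdeal (hinj : Function.Injective A.mulVec)
    (hrange : Set.range A.mulVec = {x | m ⬝ᵥ x = 0}) (hF : ∀ j, pderiv j g = ∑ i, C (A i j) * F i)
    {a : σ → MvPolynomial (Fin n) ℂ} (haF : ∑ i, a i * F i = 0) (i : σ) :
    (∑ i, C (m i) * a i) * F i ∈ jacobianIdeal g := by
  classical
  set u := ∑ i, C (m i) * a i with hu
  let w : σ → MvPolynomial (Fin n) ℂ := Pi.single i u - (C (m i) : MvPolynomial (Fin n) ℂ) • a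
  have hker : ∑ k, C (m k) * w k = 0 := by
    simp only [w, Pi.sub_apply, Pi.smul_apply, smul_eq_mul, mul_sub, Finset.sum_sub_distrib,
      mul_left_comm _ (C (m i)), ← Finset.mul_sum, ← hu]
    simp [Pi.single_apply]
  obtain ⟨b, hb, -⟩ := exists_mulVec_eq_of_sum_eq_zero hinj hrange hker
  have hsum : u * F i = ∑ j, b j * pderiv j g := by
    rw [← sum_mulVec_mul hF, hb]
    simp only [w, Pi.sub_apply, Pi.smul_apply, smul_eq_mul, sub_mul, Finset.sum_sub_distrib,
      mul_assoc, ← Finset.mul_sum, haF]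
    simp [Pi.single_apply]
  rw [hsum]
  exact Ideal.mem_span_range_iff_exists_fun.2 ⟨b, rfl⟩

theorem eq_zero_of_relation (hinj : Function.Injective A.mulVec)
    (hrange : Set.range A.mulVec = {x | m ⬝ᵥ x = 0}) (hF : ∀ j, pderiv j g = ∑ i, C (A i j) * F i)
    (hX : ∃ N, ∀ v, X v ^ N ∈ Ideal.span (Set.range F)) {e r : ℕ} (hr : SyzygiesVanishBelow g r)
    (her : e < r) (hI : ∀ u ∈ saturatedJacobianIdeal g, u.IsHomogeneous e → u = 0)
    {a : σ → MvPolynomial (Fin n) ℂ} (ha : ∀ i, (a i).IsHomogeneous e)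
    (haF : ∑ i, a i * F i = 0) : a = 0 := by
  obtain ⟨N, hN⟩ := hX
  have hma : ∑ i, C (m i) * a i = 0 := by
    refine hI _ (mem_saturatedJacobianIdeal_iff.2 ⟨N, fun v => ?_⟩)
      (IsHomogeneous.sum _ _ _ fun i _ => (ha i).C_mul _)
    exact mul_mem_jacobianIdeal_of_mem_span
      (dotProduct_mul_mem_jacobianIdeal hinj hrange hF haF) (hN v)
  obtain ⟨b, rfl, hb⟩ := exists_mulVec_eq_of_sum_eq_zero hinj hrange hma
  rw [sum_mulVec_mul hF] at haF
  rw [hr e her b haF (hb e ha), mulVec_zero]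

end Relations

section HyperplaneSection

theorem mem_projectiveZeros_mk {n d : ℕ} {f : MvPolynomial (Fin n) ℂ} (hf : f.IsHomogeneous d)
    {x : Fin n → ℂ} (hx : x ≠ 0) (h : eval x f = 0) :
    Projectivization.mk ℂ x hx ∈ projectiveZeros f := by
  obtain ⟨c, hc⟩ := Projectivization.exists_smul_eq_mk_rep ℂ x hx
  change eval (Projectivization.mk ℂ x hx).rep f = 0
  rw [← hc, Units.smul_def, eval_smul_of_isHomogeneous hf, h, mul_zero]

theorem exists_X_pow_mem_of_forall_eq_zero {σ K : Type*} [Finite σ] [Field K] [IsAlgClosed K]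
    {I : Ideal (MvPolynomial σ K)} (h : ∀ x : σ → K, (∀ p ∈ I, eval x p = 0) → x = 0) :
    ∃ N, ∀ v, X v ^ N ∈ I := by
  have hrad (v : σ) : X v ∈ I.radical := by
    rw [← vanishingIdeal_zeroLocus_eq_radical (K := K)]
    intro x hx
    rw [h x hx, aeval_X, Pi.zero_apply]
  choose N hN using hrad
  have := Fintype.ofFinite σ
  exact ⟨∑ v, N v, fun v => I.pow_mem_of_pow_mem (hN v)
    (Finset.single_le_sum (fun _ _ => Nat.zero_le _) (Finset.mem_univ v))⟩

variable {n n' d : ℕ} {f l : MvPolynomial (Fin n') ℂ} {A : Matrix (Fin n') (Fin n) ℂ}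

theorem exists_X_pow_mem_span_linearSubst_pderiv (hinj : Function.Injective A.mulVec)
    (hrange : Set.range A.mulVec = {x | eval x l = 0}) (hl : l.IsHomogeneous 1) (hd : d ≠ 0)
    (hf : f.IsHomogeneous d) (hH : singularLocus f ∩ projectiveZeros l = ∅) :
    ∃ N, ∀ v, X v ^ N ∈ Ideal.span (Set.range fun i => linearSubst A (pderiv i f)) := by
  refine exists_X_pow_mem_of_forall_eq_zero fun y hy => ?_
  by_contra hy₀
  have hx : A *ᵥ y ≠ 0 := fun h => hy₀ (hinj (h.trans (mulVec_zero A).symm))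
  have hpderiv (i : Fin n') : eval (A *ᵥ y) (pderiv i f) = 0 := by
    rw [← eval_linearSubst]
    exact hy _ (Ideal.subset_span (Set.mem_range_self i))
  have hlx : eval (A *ᵥ y) l = 0 := hrange.subset (Set.mem_range_self y)
  have hfx : eval (A *ᵥ y) f = 0 := by
    have heuler := congrArg (eval (A *ᵥ y)) hf.sum_X_mul_pderiv
    simp only [map_sum, map_mul, hpderiv, mul_zero, Finset.sum_const_zero, map_nsmul] at heuler
    exact (smul_eq_zero.1 heuler.symm).resolve_left hd
  exact hH.subset ⟨⟨mem_projectiveZeros_mk hf hx hfx,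
    fun i => mem_projectiveZeros_mk hf.pderiv hx (hpderiv i)⟩, mem_projectiveZeros_mk hl hx hlx⟩

theorem mem_jacobianIdeal_of_mul_mem {k : ℕ} (hf : f.IsHomogeneous d) (hl : l.IsHomogeneous 1)
    (hl0 : l ≠ 0) (hrange : Set.range A.mulVec = {x | eval x l = 0})
    (hrel : ∀ e, d - 1 + e = k + 1 → ∀ a : Fin n' → MvPolynomial (Fin n) ℂ,
      (∀ i, (a i).IsHomogeneous e) → ∑ i, a i * linearSubst A (pderiv i f) = 0 → a = 0)
    {q : MvPolynomial (Fin n') ℂ} (hq : q.IsHomogeneous k) (hlq : l * q ∈ jacobianIdeal f) :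
    q ∈ jacobianIdeal f := by
  have hlqk : (l * q).IsHomogeneous (k + 1) := add_comm 1 k ▸ hl.mul hq
  rcases lt_or_ge (k + 1) (d - 1) with hlt | hge
  · have hlq₀ := eq_zero_of_mem_span_of_lt (fun _ => hf.pderiv) (fun _ => hlt) hlqk hlq
    rw [(mul_eq_zero.1 hlq₀).resolve_left hl0]
    exact zero_mem _
  obtain ⟨e, he⟩ := Nat.exists_eq_add_of_le hge
  obtain ⟨a, ha, haf⟩ := exists_isHomogeneous_of_mem_span (fun _ => hf.pderiv) (he ▸ hlqk) hlq
  have hl_res : linearSubst A l = 0 := by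
    refine MvPolynomial.funext fun y => ?_
    rw [eval_linearSubst, map_zero]
    exact hrange.subset (Set.mem_range_self y)
  have ha_res := hrel e he.symm (fun i => linearSubst A (a i))
    (fun i => isHomogeneous_linearSubst A (ha i)) (by
      simp only [← map_mul, ← map_sum, haf]
      rw [map_mul, hl_res, zero_mul])
  choose c hc using fun i => dvd_of_linearSubst_eq_zero hl hl0 hrange (congrFun ha_res i)
  refine Ideal.mem_span_range_iff_exists_fun.2 ⟨c, mul_left_cancel₀ hl0 ?_⟩
  rw [← haf, Finset.mul_sum]
  exact Finset.sum_congr rfl fun i _ => by rw [hc i, mul_assoc]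

end HyperplaneSection

section PlaneCurves

variable {g : MvPolynomial (Fin 3) ℂ} {d₁ d₂ : ℕ}

theorem IsFreeCurve.rank_jacobianModulePiece_eq_zero (h : IsFreeCurve g d₁ d₂) (j : ℕ) :
    Module.rank ℂ (jacobianModulePiece g j) = 0 := by
  obtain ⟨-, b, -⟩ := h
  have := Module.Free.of_basis b
  rw [jacobianModulePiece_eq_bot (saturatedJacobianIdeal_eq_of_flat le_rfl), rank_bot]

theorem IsFreeCurve.syzygiesVanishBelow (h : IsFreeCurve g d₁ d₂) (hd : d₁ ≤ d₂) :
    SyzygiesVanishBelow g d₁ := by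
  obtain ⟨-, b, hb₀, hb₁⟩ := h
  refine syzygiesVanishBelow_of_span_eq (ρ := Subtype.val ∘ b) (D := ![d₁, d₂]) ?_
    (Fin.forall_fin_two.2 ⟨hb₀, hb₁⟩) (Fin.forall_fin_two.2 ⟨le_rfl, hd⟩)
  rw [Set.range_comp, ← Submodule.coe_subtype, ← Submodule.map_span, b.span_eq,
    Submodule.map_subtype_top]

theorem HasNearlyFreeExponents.syzygiesVanishBelow (h : HasNearlyFreeExponents g d₁ d₂)
    (hd : d₁ ≤ d₂) : SyzygiesVanishBelow g d₁ := by
  obtain ⟨ρ, hρ, -, h₀, h₁, h₂⟩ := h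
  exact syzygiesVanishBelow_of_span_eq (D := ![d₁, d₂, d₂]) hρ
    (Fin.forall_fin_succ.2 ⟨h₀, Fin.forall_fin_two.2 ⟨h₁, h₂⟩⟩)
    (Fin.forall_fin_succ.2 ⟨le_rfl, Fin.forall_fin_two.2 ⟨hd, hd⟩⟩)

theorem rank_jacobianModulePiece_add_two_le_and_syzygiesVanishBelow
    (hC : IsFreeCurve g d₁ d₂ ∨ (IsNearlyFreeCurve g ∧ HasNearlyFreeExponents g d₁ d₂))
    (hd : d₁ ≤ d₂) :
    (∀ j, Module.rank ℂ (jacobianModulePiece g j) + 2 ≤ (3 : ℕ)) ∧ SyzygiesVanishBelow g d₁ := by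
  have hthree {c : Cardinal} (hc : c ≤ 1) : c + 2 ≤ (3 : ℕ) :=
    (add_le_add_left hc 2).trans (by norm_num)
  rcases hC with hfree | ⟨⟨-, -, hN⟩, hexp⟩
  · exact ⟨fun j => hthree ((hfree.rank_jacobianModulePiece_eq_zero j).trans_le zero_le_one),
      hfree.syzygiesVanishBelow hd⟩
  · exact ⟨fun j => hthree (hN j), hexp.syzygiesVanishBelow hd⟩

end PlaneCurves

end JacobianLefschetz

open MvPolynomial Matrix JacobianLefschetz in
theorem proposition3p4_general {n n' d r k : ℕ} {f l : MvPolynomial (Fin n') ℂ}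
    {A : Matrix (Fin n') (Fin n) ℂ} (hd : 3 ≤ d) (hf : f.IsHomogeneous d)
    (hl : l.IsHomogeneous 1) (hl0 : l ≠ 0) (hH : singularLocus f ∩ projectiveZeros l = ∅)
    (hinj : Function.Injective A.mulVec) (hrange : Set.range A.mulVec = {x | eval x l = 0})
    (hN : ∀ j, Module.rank ℂ (jacobianModulePiece (linearSubst A f) j) + 2 ≤ n)
    (hr : SyzygiesVanishBelow (linearSubst A f) r) (hk : k + 3 ≤ d + r) :
    Function.Injective (mulByLinearForm f l hl k) := by
  rw [injective_iff_map_eq_zero]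
  rintro ⟨_, q, hq, rfl⟩ hx
  have hlq : l * q ∈ jacobianIdeal f := by
    rw [← Ideal.Quotient.eq_zero_iff_mem, map_mul]
    exact congrArg Subtype.val hx
  refine Subtype.ext (Ideal.Quotient.eq_zero_iff_mem.2
    (mem_jacobianIdeal_of_mul_mem hf hl hl0 hrange (fun e he a ha haF => ?_) hq hlq))
  obtain ⟨m, hm⟩ := exists_eq_sum_C_mul_X hl
  have hrange_dot : Set.range A.mulVec = {x | m ⬝ᵥ x = 0} := by
    simpa only [hm, map_sum, map_mul, eval_C, eval_X, dotProduct] using hrange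
  have her : e < r := by omega
  exact eq_zero_of_relation hinj hrange_dot (pderiv_linearSubst A f)
    (exists_X_pow_mem_span_linearSubst_pderiv hinj hrange hl (by omega) hf hH) hr her
    (fun u hu hue => hr.eq_zero_of_mem_saturatedJacobianIdeal (isHomogeneous_linearSubst A hf) hd
      (hN (e + 1)) hu hue her) ha haF

theorem proposition3p4
    (d : ℕ) (hd : 3 ≤ d)
    (f : MvPolynomial (Fin 4) ℂ) (hf : f.IsHomogeneous d)
    (hsing : JacobianLefschetz.HasIsolatedSingularities f)
    (l : MvPolynomial (Fin 4) ℂ) (hl : l.IsHomogeneous 1) (hl0 : l ≠ 0)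
    (hH : JacobianLefschetz.singularLocus f ∩ JacobianLefschetz.projectiveZeros l = ∅)
    (A : Matrix (Fin 4) (Fin 3) ℂ) (hA : JacobianLefschetz.IsCoordinateSystem l A)
    (d₁ d₂ : ℕ) (hd₁₂ : d₁ ≤ d₂)
    (hC : JacobianLefschetz.IsFreeCurve (JacobianLefschetz.restrictToPlane f A) d₁ d₂ ∨
      (JacobianLefschetz.IsNearlyFreeCurve (JacobianLefschetz.restrictToPlane f A) ∧
        JacobianLefschetz.HasNearlyFreeExponents (JacobianLefschetz.restrictToPlane f A) d₁ d₂))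
    (k : ℕ) (hk : (k : ℤ) ≤ (d : ℤ) + d₁ - 3) :
    Function.Injective (JacobianLefschetz.mulByLinearForm f l hl k) := by
  obtain ⟨hN, hr⟩ :=
    JacobianLefschetz.rank_jacobianModulePiece_add_two_le_and_syzygiesVanishBelow hC hd₁₂
  exact proposition3p4_general hd hf hl hl0 hH hA.1 hA.2 hN hr (by omega)
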